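/- Let $n\ge 1$, let $x_1<\dots<x_n$ and $y_1<\dots<y_n$ be real numbers, and let $\mu_0=\frac1n\sum_{i=1}^n\delta_{x_i}$ and $\mu_1=\frac1n\sum_{i=1}^n\delta_{y_i}$. Let $\mathcal P_2(\mathbb R)$ be the set of probability measures on $\mathbb R$ with finite second moment, with the 2-Wasserstein distance $\mathrm W_2(\mu,\nu)=\big(\inf_{\gamma}\int |x-y|^2\,\mathrm d\gamma(x,y)\big)^{1/2}$, the infimum being over all couplings $\gamma$ of $\mu$ and $\nu$. Let $F_0^{-1},F_1^{-1}$ be the quantile functions of $\mu_0,\mu_1$, and for $t\ge 0$ let $\mu_t=\big((1-t)\pi^1+t\pi^2\big)_\#\gamma$ with $\gamma=(F_0^{-1},F_1^{-1})_\#\mathrm{Unif}([0,1])$ and $\pi^1,\pi^2$ the coordinate projections; $(\mu_t)_{t\in[0,1]}$ is the geodesic between $\mu_0$ and $\mu_1$. A curve $(\nu_t)_{t\ge0}$ in $\mathcal P_2(\mathbb R)$ is called a geodesic ray if $\mathrm W_2(\nu_t,\nu_s)=|t-s|\,\mathrm W_2(\nu_0,\nu_1)$ for all $s,t\ge 0$.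 Then the geodesic between $\mu_0$ and $\mu_1$ is a ray if and only if $y_i-y_j\le x_i-x_j$ for all $j>i$. This holds in both senses of being a ray: the geodesic $(\mu_t)_{t\in[0,1]}$ extends to some geodesic ray if and only if this condition holds, and the curve $(\mu_t)_{t\ge 0}$ is a geodesic ray if and only if this condition holds. -/

import Mathlib

open MeasureTheory Set
open scoped ENNReal

noncomputable section

/-- The set `𝒫₂(ℝ)` of probability measures on `ℝ` with finite second moment. -/
def P2 : Set (Measure ℝ) :=
  {μ | IsProbabilityMeasure μ ∧ ∫⁻ x, ‖x‖ₑ ^ 2 ∂μ < ∞}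

/-- The set `Π(μ, ν)` of couplings of `μ` and `ν`. -/
def couplings (μ ν : Measure ℝ) : Set (Measure (ℝ × ℝ)) :=
  {γ | IsProbabilityMeasure γ ∧ γ.map Prod.fst = μ ∧ γ.map Prod.snd = ν}

/-- The squared 2-Wasserstein distance `inf_{γ ∈ Π(μ, ν)} ∫ |x - y|² dγ(x, y)`
(a finite number whenever `μ` and `ν` belong to `𝒫₂(ℝ)`). -/
def W2sq (μ ν : Measure ℝ) : ℝ≥0∞ :=
  ⨅ γ ∈ couplings μ ν, ∫⁻ p, ‖p.1 - p.2‖ₑ ^ 2 ∂γ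

/-- The 2-Wasserstein distance. -/
def W2 (μ ν : Measure ℝ) : ℝ≥0∞ :=
  W2sq μ ν ^ (1 / 2 : ℝ)

/-- The quantile function `F_μ⁻¹(u) = inf {z | u ≤ F_μ(z)}`, where `F_μ` is the cumulative
distribution function of `μ` (only its values at `u ∈ (0, 1)` matter). -/
def quantile (μ : Measure ℝ) (u : ℝ) : ℝ :=
  sInf {z : ℝ | u ≤ ProbabilityTheory.cdf μ z}

/-- The uniform distribution on `[0, 1]`. -/
def unif01 : Measure ℝ := volume.restrict (Icc 0 1)

/-- The optimal coupling `(F_μ⁻¹, F_ν⁻¹)_# Unif([0, 1])` of `μ` and `ν`. -/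
def monotoneCoupling (μ ν : Measure ℝ) : Measure (ℝ × ℝ) :=
  unif01.map fun u => (quantile μ u, quantile ν u)

/-- The curve `t ↦ ((1 - t) π¹ + t π²)_# γ`, with `γ` the optimal coupling of `μ₀` and `μ₁`.
Its restriction to `[0, 1]` is the Wasserstein geodesic between `μ₀` and `μ₁`. -/
def geodesicCurve (μ₀ μ₁ : Measure ℝ) (t : ℝ) : Measure ℝ :=
  (monotoneCoupling μ₀ μ₁).map fun p => (1 - t) * p.1 + t * p.2

/-- The curve `c`, restricted to `t ≥ 0`, is a geodesic ray of `(𝒫₂(ℝ), W₂)`: it takes values in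
`𝒫₂(ℝ)` and `W₂(c t, c s) = |t - s| W₂(c 0, c 1)` for all `s, t ≥ 0`. -/
def IsGeodesicRay (c : ℝ → Measure ℝ) : Prop :=
  (∀ t, 0 ≤ t → c t ∈ P2) ∧
    ∀ s t, 0 ≤ s → 0 ≤ t → W2 (c t) (c s) = ENNReal.ofReal |t - s| * W2 (c 0) (c 1)

/-- The geodesic between `μ₀` and `μ₁`, a curve on `[0, 1]`, can be extended to a geodesic ray. -/
def GeodesicExtendsToRay (μ₀ μ₁ : Measure ℝ) : Prop :=
  ∃ c : ℝ → Measure ℝ, IsGeodesicRay c ∧ ∀ t ∈ Icc (0 : ℝ) 1, c t = geodesicCurve μ₀ μ₁ t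

/-- The uniform empirical measure `(1/n) ∑ᵢ δ_{x i}`. -/
def empirical {n : ℕ} (x : Fin n → ℝ) : Measure ℝ :=
  (n : ℝ≥0∞)⁻¹ • ∑ i, Measure.dirac (x i)

end

/-! Between strictly ordered uniform point sets the increasing matching is optimal, by Birkhoff and
rearrangement (`W2sq_empirical`). Under the gap condition the points `(1 - t) x i + t y i` stay
ordered for all `t ≥ 0`, so the distances along the curve are explicit.

Conversely, let `ν` be the value at time `T > 1` of any ray extending the geodesic. In a nearly
optimal coupling of `empirical y` and `ν`, relabelling `y i` as `x i` gives a coupling of `empirical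
x` and `ν`. A quadratic identity then forces the second coordinate to be L²-close to `z i = (1 - T)
x i + T y i`. Relabelling `y i` as `x (σ i)` instead shows that no permutation beats the matching of
`x i` with `z i` (`sq_mul_cost_le_of_extension`). Transpositions give `z i ≤ z j` for `i < j`, and
large `T` yields the gap condition. Neither an optimal coupling nor the shape of `ν` is needed. -/

/-! ### Empirical measures -/

theorem lintegral_empirical {n : ℕ} (x : Fin n → ℝ) (f : ℝ → ℝ≥0∞) :
    ∫⁻ r, f r ∂(empirical x) = (n : ℝ≥0∞)⁻¹ * ∑ i, f (x i) := by
  simp [empirical, lintegral_finsetSum_measure]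

theorem integral_empirical {n : ℕ} (x : Fin n → ℝ) (f : ℝ → ℝ) :
    ∫ r, f r ∂(empirical x) = (n : ℝ)⁻¹ * ∑ i, f (x i) := by
  rw [empirical, integral_smul_measure, integral_finsetSum_measure]
  · simp
  · exact fun i _ => integrable_dirac (by simp)

theorem isProbabilityMeasure_empirical {n : ℕ} (hn : 0 < n) (x : Fin n → ℝ) :
    IsProbabilityMeasure (empirical x) := by
  constructor
  have := lintegral_empirical x (fun _ => 1)
  simp only [lintegral_one] at this
  rw [this]
  simp only [Finset.sum_const, Finset.card_univ, Fintype.card_fin, nsmul_eq_mul, mul_one]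
  exact ENNReal.inv_mul_cancel (by simp [hn.ne']) (by simp)

theorem empirical_mem_P2 {n : ℕ} (hn : 0 < n) (x : Fin n → ℝ) : empirical x ∈ P2 := by
  refine ⟨isProbabilityMeasure_empirical hn x, ?_⟩
  rw [lintegral_empirical]
  exact ENNReal.mul_lt_top (by simp [hn]) (by simp [ENNReal.sum_lt_top])

theorem map_empirical {n : ℕ} (x : Fin n → ℝ) {g : ℝ → ℝ} (hg : Measurable g) :
    (empirical x).map g = empirical (g ∘ x) := by
  refine Measure.ext_of_lintegral _ fun f hf => ?_
  rw [lintegral_map hf hg, lintegral_empirical, lintegral_empirical]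
  rfl

theorem empirical_comp_perm {n : ℕ} (x : Fin n → ℝ) (σ : Equiv.Perm (Fin n)) :
    empirical (x ∘ σ) = empirical x := by
  simp only [empirical, Function.comp]
  rw [Equiv.sum_comp σ fun i => Measure.dirac (x i)]

theorem enorm_sq_eq_ofReal (r : ℝ) : ‖r‖ₑ ^ 2 = ENNReal.ofReal (r ^ 2) := by
  rw [← ofReal_norm, ← ENNReal.ofReal_pow (norm_nonneg r), Real.norm_eq_abs, sq_abs]

/-! ### Optimal transport between ordered point sets -/

/-- Rearrangement inequality for doubly stochastic matrices. -/
theorem sum_sq_sub_le_of_mem_doublyStochastic {n : ℕ} {a b : Fin n → ℝ}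
    (ha : Monotone a) (hb : Monotone b) {M : Matrix (Fin n) (Fin n) ℝ}
    (hM : M ∈ doublyStochastic ℝ (Fin n)) :
    ∑ i, (a i - b i) ^ 2 ≤ ∑ i, ∑ j, M i j * (a i - b j) ^ 2 := by
  -- Birkhoff's theorem: the cost is linear in `M`, so permutation matrices suffice.
  obtain ⟨w, hw0, hw1, rfl⟩ := exists_eq_sum_perm_of_mem_doublyStochastic hM
  have key (σ : Equiv.Perm (Fin n)) :
      ∑ i, (a i - b i) ^ 2 ≤ ∑ i, (a i - b (σ i)) ^ 2 := by
    have h1 := (ha.monovary hb).sum_mul_comp_perm_le_sum_mul (σ := σ)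
    have h2 : ∑ i, b (σ i) ^ 2 = ∑ i, b i ^ 2 := Equiv.sum_comp σ fun i => b i ^ 2
    simp only [sub_sq, Finset.sum_add_distrib, Finset.sum_sub_distrib, mul_assoc,
      ← Finset.mul_sum]
    linarith
  calc ∑ i, (a i - b i) ^ 2 = ∑ σ, w σ * ∑ i, (a i - b i) ^ 2 := by
        rw [← Finset.sum_mul, hw1, one_mul]
    _ ≤ ∑ σ, w σ * ∑ i, (a i - b (σ i)) ^ 2 :=
        Finset.sum_le_sum fun σ _ => mul_le_mul_of_nonneg_left (key σ) (hw0 σ)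
    _ = _ := by
        simp only [Matrix.sum_apply, Matrix.smul_apply, smul_eq_mul, Finset.sum_mul]
        simp_rw [Finset.mul_sum]
        rw [Finset.sum_comm]
        refine Finset.sum_congr rfl fun i _ => ?_
        rw [Finset.sum_comm]
        refine Finset.sum_congr rfl fun σ _ => ?_
        simp [Equiv.toPEquiv_apply, PEquiv.toMatrix_apply, Equiv.Perm.permMatrix]

theorem empirical_apply_singleton {n : ℕ} {x : Fin n → ℝ} (hx : Function.Injective x)
    (i : Fin n) : empirical x {x i} = (n : ℝ≥0∞)⁻¹ := by
  rw [← lintegral_indicator_one (measurableSet_singleton _), lintegral_empirical]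
  simp [Set.indicator_apply, hx.eq_iff]

theorem empirical_compl_range {n : ℕ} (x : Fin n → ℝ) : empirical x (range x)ᶜ = 0 := by
  rw [← lintegral_indicator_one (Set.finite_range x).measurableSet.compl, lintegral_empirical]
  simp

/-- The second marginal is null off the range of `b`, so the fibre over `a i` carries mass only at
the grid points `(a i, b j)`. -/
theorem coupling_row_sum {n : ℕ} {a b : Fin n → ℝ} (ha : Function.Injective a)
    (hb : Function.Injective b) {γ : Measure (ℝ × ℝ)} [IsProbabilityMeasure γ]
    (h1 : γ.map Prod.fst = empirical a) (h2 : γ.map Prod.snd = empirical b) (i : Fin n) :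
    ∑ j, γ.real {(a i, b j)} = (n : ℝ)⁻¹ := by
  have hU : γ (Prod.fst ⁻¹' {a i}) = ∑ j, γ {(a i, b j)} := by
    have hs : γ (Prod.fst ⁻¹' {a i}) = γ (⋃ j ∈ Finset.univ, {(a i, b j)}) := by
      refine le_antisymm ?_ (measure_mono ?_)
      · have h0 : γ (Prod.snd ⁻¹' (range b)ᶜ) = 0 := by
          rw [← Measure.map_apply measurable_snd (Set.finite_range b).measurableSet.compl, h2]
          exact empirical_compl_range b
        refine (measure_mono (t := (⋃ j ∈ Finset.univ, {(a i, b j)}) ∪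
          (Prod.snd ⁻¹' (range b)ᶜ)) ?_).trans ((measure_union_le _ _).trans (by rw [h0, add_zero]))
        rintro ⟨p, q⟩ hp
        by_cases hq : q ∈ range b
        · obtain ⟨j, rfl⟩ := hq
          left
          simp only [mem_preimage, mem_singleton_iff] at hp
          simp [hp]
        · right; simpa using hq
      · intro p hp
        simp only [mem_iUnion, mem_singleton_iff] at hp
        obtain ⟨j, -, rfl⟩ := hp
        simp
    rw [hs, measure_biUnion_finset]
    · intro j _ k _ hjk
      simpa [Function.onFun, hb.eq_iff] using hjk
    · exact fun j _ => measurableSet_singleton _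
  rw [← Measure.map_apply measurable_fst (measurableSet_singleton _), h1,
    empirical_apply_singleton ha] at hU
  simp only [measureReal_def]
  rw [← ENNReal.toReal_sum (fun j _ => measure_ne_top _ _), ← hU]
  simp

theorem coupling_swap {μ ν : Measure ℝ} {γ : Measure (ℝ × ℝ)} (h : γ ∈ couplings μ ν) :
    γ.map Prod.swap ∈ couplings ν μ := by
  obtain ⟨h0, h1, h2⟩ := h
  refine ⟨Measure.isProbabilityMeasure_map measurable_swap.aemeasurable, ?_, ?_⟩
  · rw [Measure.map_map measurable_fst measurable_swap]; exact h2
  · rw [Measure.map_map measurable_snd measurable_swap]; exact h1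

theorem coupling_mem_doublyStochastic {n : ℕ} (hn : 0 < n) {a b : Fin n → ℝ}
    (ha : Function.Injective a) (hb : Function.Injective b) {γ : Measure (ℝ × ℝ)}
    (h : γ ∈ couplings (empirical a) (empirical b)) :
    (Matrix.of fun i j => (n : ℝ) * γ.real {(a i, b j)}) ∈ doublyStochastic ℝ (Fin n) := by
  have hn' : (n : ℝ) ≠ 0 := by positivity
  have hs := coupling_swap h
  obtain ⟨h0, h1, h2⟩ := h
  rw [mem_doublyStochastic_iff_sum]
  refine ⟨fun i j => by simp; positivity, fun i => ?_, fun j => ?_⟩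
  · simp only [Matrix.of_apply, ← Finset.mul_sum]
    rw [coupling_row_sum ha hb h1 h2, mul_inv_cancel₀ hn']
  · obtain ⟨h0', h1', h2'⟩ := hs
    have := coupling_row_sum hb ha h1' h2' j
    simp only [Matrix.of_apply, ← Finset.mul_sum]
    have e (i : Fin n) : (γ.map Prod.swap).real {(b j, a i)} = γ.real {(a i, b j)} := by
      rw [map_measureReal_apply measurable_swap (measurableSet_singleton _)]
      congr 1
      ext ⟨p, q⟩
      simp [and_comm]
    simp only [e] at this
    rw [this, mul_inv_cancel₀ hn']

theorem empirical_cost_le_of_coupling {n : ℕ} (hn : 0 < n) {a b : Fin n → ℝ}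
    (ha : StrictMono a) (hb : StrictMono b) {γ : Measure (ℝ × ℝ)}
    (h : γ ∈ couplings (empirical a) (empirical b)) :
    ENNReal.ofReal ((n : ℝ)⁻¹ * ∑ i, (a i - b i) ^ 2) ≤ ∫⁻ p, ‖p.1 - p.2‖ₑ ^ 2 ∂γ := by
  have hM := coupling_mem_doublyStochastic hn ha.injective hb.injective h
  obtain ⟨h0, h1, h2⟩ := h
  have hn' : (0 : ℝ) < n := by positivity
  let e : Fin n × Fin n ↪ ℝ × ℝ :=
    ⟨fun p => (a p.1, b p.2), fun p q hpq => by
      simp only [Prod.mk.injEq, ha.injective.eq_iff, hb.injective.eq_iff] at hpq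
      exact Prod.ext hpq.1 hpq.2⟩
  calc ENNReal.ofReal ((n : ℝ)⁻¹ * ∑ i, (a i - b i) ^ 2)
      ≤ ENNReal.ofReal (∑ i, ∑ j, γ.real {(a i, b j)} * (a i - b j) ^ 2) := by
        refine ENNReal.ofReal_le_ofReal ?_
        rw [inv_mul_le_iff₀ hn']
        refine (sum_sq_sub_le_of_mem_doublyStochastic ha.monotone hb.monotone hM).trans_eq ?_
        simp only [Matrix.of_apply, Finset.mul_sum, mul_assoc]
    _ = ∫⁻ p in (Finset.univ.map e : Finset (ℝ × ℝ)), ‖p.1 - p.2‖ₑ ^ 2 ∂γ := by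
        rw [lintegral_finset, Finset.sum_map, ← Finset.univ_product_univ, Finset.sum_product,
          ENNReal.ofReal_sum_of_nonneg fun i _ => Finset.sum_nonneg fun j _ => by positivity]
        refine Finset.sum_congr rfl fun i _ => ?_
        rw [ENNReal.ofReal_sum_of_nonneg fun j _ => by positivity]
        refine Finset.sum_congr rfl fun j _ => ?_
        rw [ENNReal.ofReal_mul (by positivity), ofReal_measureReal, mul_comm,
          enorm_sq_eq_ofReal]
        rfl
    _ ≤ _ := setLIntegral_le_lintegral _ _

theorem W2sq_le_of_coupling {μ ν : Measure ℝ} {γ : Measure (ℝ × ℝ)} (h : γ ∈ couplings μ ν) :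
    W2sq μ ν ≤ ∫⁻ p, ‖p.1 - p.2‖ₑ ^ 2 ∂γ := iInf₂_le γ h

theorem W2sq_empirical_le {n : ℕ} (hn : 0 < n) (a b : Fin n → ℝ) :
    W2sq (empirical a) (empirical b) ≤ ENNReal.ofReal ((n : ℝ)⁻¹ * ∑ i, (a i - b i) ^ 2) := by
  let γ : Measure (ℝ × ℝ) := (n : ℝ≥0∞)⁻¹ • ∑ i, Measure.dirac (a i, b i)
  have hγ (f : ℝ × ℝ → ℝ≥0∞) : ∫⁻ p, f p ∂γ = (n : ℝ≥0∞)⁻¹ * ∑ i, f (a i, b i) := by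
    simp [γ, lintegral_finsetSum_measure]
  have hc : γ ∈ couplings (empirical a) (empirical b) := by
    have h1 : γ.map Prod.fst = empirical a := by
      refine Measure.ext_of_lintegral _ fun f hf => ?_
      rw [lintegral_map hf measurable_fst, hγ, lintegral_empirical]
    have h2 : γ.map Prod.snd = empirical b := by
      refine Measure.ext_of_lintegral _ fun f hf => ?_
      rw [lintegral_map hf measurable_snd, hγ, lintegral_empirical]
    refine ⟨?_, h1, h2⟩
    have := isProbabilityMeasure_empirical hn a
    rw [← h1] at this
    exact Measure.isProbabilityMeasure_of_map Prod.fst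
  refine (W2sq_le_of_coupling hc).trans_eq ?_
  rw [hγ, ENNReal.ofReal_mul (by positivity), ENNReal.ofReal_inv_of_pos (by positivity),
    ENNReal.ofReal_natCast, ENNReal.ofReal_sum_of_nonneg fun i _ => by positivity]
  simp only [enorm_sq_eq_ofReal]

theorem W2sq_empirical {n : ℕ} (hn : 0 < n) {a b : Fin n → ℝ}
    (ha : StrictMono a) (hb : StrictMono b) :
    W2sq (empirical a) (empirical b) = ENNReal.ofReal ((n : ℝ)⁻¹ * ∑ i, (a i - b i) ^ 2) :=
  (W2sq_empirical_le hn a b).antisymm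
    (le_iInf₂ fun _ h => empirical_cost_le_of_coupling hn ha hb h)

/-- Lets the ray equation be handled without square roots. -/
theorem W2_eq_ofReal_mul_iff {μ₀ μ₁ ν₀ ν₁ : Measure ℝ} {r : ℝ} (hr : 0 ≤ r) :
    W2 ν₀ ν₁ = ENNReal.ofReal r * W2 μ₀ μ₁ ↔
      W2sq ν₀ ν₁ = ENNReal.ofReal (r ^ 2) * W2sq μ₀ μ₁ := by
  have h : ENNReal.ofReal r = ENNReal.ofReal (r ^ 2) ^ (1 / 2 : ℝ) := by
    rw [ENNReal.ofReal_rpow_of_nonneg (by positivity) (by positivity), ← Real.sqrt_eq_rpow,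
      Real.sqrt_sq hr]
  rw [W2, W2, h, ← ENNReal.mul_rpow_of_nonneg _ _ (by positivity)]
  exact (ENNReal.rpow_left_injective (by norm_num)).eq_iff

/-! ### Quantile functions and the explicit geodesic -/

theorem cdf_empirical {n : ℕ} (hn : 0 < n) (x : Fin n → ℝ) (z : ℝ) :
    ProbabilityTheory.cdf (empirical x) z
      = (n : ℝ)⁻¹ * ((Finset.univ.filter fun i => x i ≤ z).card : ℝ) := by
  have := isProbabilityMeasure_empirical hn x
  rw [ProbabilityTheory.cdf_eq_real, ← integral_indicator_one measurableSet_Iic,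
    integral_empirical]
  simp [Set.indicator_apply]

theorem le_cdf_empirical_iff {n : ℕ} {x : Fin n → ℝ} (hx : StrictMono x)
    (k : Fin n) {u : ℝ} (hu : u ∈ Ioc ((k : ℝ) / n) ((k + 1 : ℝ) / n)) (z : ℝ) :
    u ≤ ProbabilityTheory.cdf (empirical x) z ↔ x k ≤ z := by
  have hn : 0 < n := k.pos
  have hn' : (0 : ℝ) < n := by positivity
  rw [cdf_empirical hn, ← div_eq_inv_mul]
  constructor
  · intro h
    by_contra! hz
    have hsub : (Finset.univ.filter fun i => x i ≤ z) ⊆ Finset.Iio k := by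
      intro i hi
      simp only [Finset.mem_filter, Finset.mem_univ, true_and] at hi
      exact Finset.mem_Iio.2 (hx.lt_iff_lt.1 (hi.trans_lt hz))
    have hc := Finset.card_le_card hsub
    rw [Fin.card_Iio] at hc
    have : u ≤ (k : ℝ) / n := h.trans (by gcongr)
    exact absurd hu.1 this.not_gt
  · intro hz
    have hsub : Finset.Iic k ⊆ Finset.univ.filter fun i => x i ≤ z := by
      intro i hi
      simp only [Finset.mem_filter, Finset.mem_univ, true_and]
      exact (hx.monotone (Finset.mem_Iic.1 hi)).trans hz
    have hc := Finset.card_le_card hsub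
    rw [Fin.card_Iic] at hc
    refine hu.2.trans ?_
    gcongr
    exact_mod_cast hc

theorem quantile_empirical {n : ℕ} {x : Fin n → ℝ} (hx : StrictMono x)
    (k : Fin n) {u : ℝ} (hu : u ∈ Ioc ((k : ℝ) / n) ((k + 1 : ℝ) / n)) :
    quantile (empirical x) u = x k := by
  simp only [quantile, le_cdf_empirical_iff hx k hu]
  exact csInf_Ici

/-- The index `k` of the interval `(k / n, (k + 1) / n]` containing a point of `(0, 1]`. -/
noncomputable def stepIndex {n : ℕ} (hn : 0 < n) (u : ℝ) : Fin n :=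
  -- The minimum and the truncated subtraction matter only outside `(0, 1]`, where they keep the
  -- index in range.
  ⟨min (⌈n * u⌉₊ - 1) (n - 1), by omega⟩

theorem measurable_stepIndex {n : ℕ} (hn : 0 < n) : Measurable (stepIndex hn) := by
  have h : Measurable fun m : ℕ => (⟨min (m - 1) (n - 1), by omega⟩ : Fin n) :=
    measurable_from_top
  exact h.comp (Nat.measurable_ceil.comp (measurable_const_mul _))

theorem stepIndex_eq_iff {n : ℕ} (hn : 0 < n) {u : ℝ} (hu : u ∈ Ioc (0 : ℝ) 1) (k : Fin n) :
    stepIndex hn u = k ↔ u ∈ Ioc ((k : ℝ) / n) ((k + 1 : ℝ) / n) := by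
  have hn' : (0 : ℝ) < n := by positivity
  have h1 : ⌈n * u⌉₊ ≤ n := Nat.ceil_le.2 (by nlinarith [hu.2])
  have h2 : 0 < ⌈n * u⌉₊ := Nat.ceil_pos.2 (mul_pos hn' hu.1)
  have h3 : stepIndex hn u = k ↔ ⌈n * u⌉₊ = k + 1 := by
    rw [Fin.ext_iff]
    simp only [stepIndex]
    omega
  rw [h3, Nat.ceil_eq_iff (by omega), mem_Ioc, div_lt_iff₀ hn', le_div_iff₀ hn', mul_comm]
  simp

theorem unif01_eq_restrict_Ioc : unif01 = volume.restrict (Ioc 0 1) :=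
  (Measure.restrict_congr_set Ioc_ae_eq_Icc).symm

theorem unif01_stepIndex_preimage {n : ℕ} (hn : 0 < n) (k : Fin n) :
    unif01 (stepIndex hn ⁻¹' {k}) = (n : ℝ≥0∞)⁻¹ := by
  have hn' : (0 : ℝ) < n := by positivity
  rw [unif01_eq_restrict_Ioc,
    Measure.restrict_apply (measurable_stepIndex hn (measurableSet_singleton k))]
  have : stepIndex hn ⁻¹' {k} ∩ Ioc 0 1 = Ioc ((k : ℝ) / n) ((k + 1 : ℝ) / n) := by
    ext u
    constructor
    · rintro ⟨h, hu⟩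
      exact (stepIndex_eq_iff hn hu k).1 h
    · intro h
      have hu : u ∈ Ioc (0 : ℝ) 1 := by
        refine ⟨lt_of_le_of_lt (by positivity) h.1, h.2.trans ?_⟩
        rw [div_le_one hn']
        exact_mod_cast k.isLt
      exact ⟨(stepIndex_eq_iff hn hu k).2 h, hu⟩
  rw [this, Real.volume_Ioc, ← sub_div, add_sub_cancel_left, one_div,
    ENNReal.ofReal_inv_of_pos hn', ENNReal.ofReal_natCast]

theorem quantile_ae_eq_stepIndex {n : ℕ} (hn : 0 < n) {x : Fin n → ℝ} (hx : StrictMono x) :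
    ∀ᵐ u ∂unif01, quantile (empirical x) u = x (stepIndex hn u) := by
  rw [unif01_eq_restrict_Ioc]
  filter_upwards [ae_restrict_mem measurableSet_Ioc] with u hu
  exact quantile_empirical hx _ ((stepIndex_eq_iff hn hu _).1 rfl)

/-- Both quantile functions factor almost everywhere through `stepIndex`, whose law under `unif01`
is uniform on `Fin n`. -/
theorem geodesicCurve_empirical {n : ℕ} (hn : 0 < n) {x y : Fin n → ℝ}
    (hx : StrictMono x) (hy : StrictMono y) (t : ℝ) :
    geodesicCurve (empirical x) (empirical y) t
      = empirical fun i => (1 - t) * x i + t * y i := by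
  have hm : Measurable fun u => (x (stepIndex hn u), y (stepIndex hn u)) :=
    (measurable_of_finite fun i => (x i, y i)).comp (measurable_stepIndex hn)
  have hp : Measurable fun p : ℝ × ℝ => (1 - t) * p.1 + t * p.2 := by fun_prop
  have hmono : monotoneCoupling (empirical x) (empirical y)
      = unif01.map fun u => (x (stepIndex hn u), y (stepIndex hn u)) := by
    refine Measure.map_congr ?_
    filter_upwards [quantile_ae_eq_stepIndex hn hx, quantile_ae_eq_stepIndex hn hy]
      with u h1 h2
    rw [h1, h2]
  refine Measure.ext_of_lintegral _ fun f hf => ?_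
  rw [geodesicCurve, hmono, lintegral_map hf hp, lintegral_map (f := fun p : ℝ × ℝ => f ((1 - t) * p.1 + t * p.2)) (hf.comp hp) hm,
    lintegral_empirical]
  have hstep := lintegral_map (μ := unif01) (f := fun i : Fin n => f ((1 - t) * x i + t * y i))
    (measurable_of_finite _) (measurable_stepIndex hn)
  refine hstep.symm.trans ?_
  rw [lintegral_fintype]
  simp only [Measure.map_apply (measurable_stepIndex hn) (measurableSet_singleton _),
    unif01_stepIndex_preimage]
  rw [← Finset.sum_mul, mul_comm]

/-! ### Sufficiency of the gap condition -/

theorem isGeodesicRay_geodesicCurve {n : ℕ} (hn : 0 < n) {x y : Fin n → ℝ}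
    (hx : StrictMono x) (hy : StrictMono y)
    (h : ∀ i j : Fin n, i < j → y i - y j ≤ x i - x j) :
    IsGeodesicRay (geodesicCurve (empirical x) (empirical y)) := by
  have hmono (t : ℝ) (ht : 0 ≤ t) : StrictMono fun i => (1 - t) * x i + t * y i := by
    intro i j hij
    have h1 := hx hij
    have h2 := mul_le_mul_of_nonneg_left (h i j hij) ht
    dsimp only
    linarith
  constructor
  · intro t _
    rw [geodesicCurve_empirical hn hx hy]
    exact empirical_mem_P2 hn _
  · intro s t hs ht
    rw [W2_eq_ofReal_mul_iff (abs_nonneg _)]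
    simp only [geodesicCurve_empirical hn hx hy]
    rw [W2sq_empirical hn (hmono t ht) (hmono s hs),
      W2sq_empirical hn (hmono 0 le_rfl) (hmono 1 zero_le_one),
      ← ENNReal.ofReal_mul (by positivity), sq_abs, mul_left_comm, Finset.mul_sum _ _ ((t - s) ^ 2)]
    congr 2
    exact Finset.sum_congr rfl fun i _ => by ring

/-! ### Necessity: relabelling near-optimal couplings -/

theorem ofReal_integral_sq {α : Type*} [MeasurableSpace α] {μ : Measure α} {f : α → ℝ}
    (hf : MemLp f 2 μ) : ENNReal.ofReal (∫ a, f a ^ 2 ∂μ) = ∫⁻ a, ‖f a‖ₑ ^ 2 ∂μ := by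
  rw [ofReal_integral_eq_lintegral_ofReal hf.integrable_sq (ae_of_all _ fun a => sq_nonneg _)]
  simp only [enorm_sq_eq_ofReal]

theorem memLp_two_of_lintegral_lt_top {α : Type*} [MeasurableSpace α] {μ : Measure α}
    {f : α → ℝ} (hf : Measurable f) (h : ∫⁻ a, ‖f a‖ₑ ^ 2 ∂μ < ∞) : MemLp f 2 μ := by
  rw [memLp_two_iff_integrable_sq hf.aestronglyMeasurable]
  refine ⟨(hf.pow_const 2).aestronglyMeasurable, ?_⟩
  rw [HasFiniteIntegral]
  simpa only [enorm_pow] using h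

theorem memLp_two_comp_fst {n : ℕ} (hn : 0 < n) {y : Fin n → ℝ} {γ : Measure (ℝ × ℝ)}
    (h : γ.map Prod.fst = empirical y) {g : ℝ → ℝ} (hg : Measurable g) :
    MemLp (fun p => g p.1) 2 γ := by
  refine memLp_two_of_lintegral_lt_top (hg.comp measurable_fst) ?_
  rw [← lintegral_map (f := fun r => ‖g r‖ₑ ^ 2) (by fun_prop) measurable_fst, h,
    lintegral_empirical]
  exact ENNReal.mul_lt_top (by simp [hn]) (by simp [ENNReal.sum_lt_top])

theorem integral_comp_fst {n : ℕ} {y : Fin n → ℝ} {γ : Measure (ℝ × ℝ)}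
    (h : γ.map Prod.fst = empirical y) {g : ℝ → ℝ} (hg : Measurable g) :
    ∫ p, g p.1 ∂γ = (n : ℝ)⁻¹ * ∑ i, g (y i) := by
  rw [← integral_empirical, ← h, integral_map measurable_fst.aemeasurable
    hg.aestronglyMeasurable]

theorem exists_measurable_apply_eq {n : ℕ} {y : Fin n → ℝ} (hy : Function.Injective y)
    (f : Fin n → ℝ) : ∃ g : ℝ → ℝ, Measurable g ∧ ∀ i, g (y i) = f i :=
  ⟨Function.extend y f 0,
    ((measurable_of_finite y).measurableEmbedding hy).measurable_extend
      (measurable_of_finite f) measurable_zero,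
    fun i => hy.extend_apply f 0 i⟩

/-- A coupling of the image of `empirical y` with `ν` obtained by relabelling the atoms. -/
theorem map_mem_couplings {n : ℕ} {y : Fin n → ℝ} {ν : Measure ℝ} {γ : Measure (ℝ × ℝ)}
    (hγ : γ ∈ couplings (empirical y) ν) {g : ℝ → ℝ} (hg : Measurable g) :
    γ.map (fun p => (g p.1, p.2)) ∈ couplings (empirical (g ∘ y)) ν := by
  obtain ⟨h0, h1, h2⟩ := hγ
  have hm : Measurable fun p : ℝ × ℝ => (g p.1, p.2) := by fun_prop
  refine ⟨Measure.isProbabilityMeasure_map hm.aemeasurable, ?_, ?_⟩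
  · rw [← map_empirical y hg, ← h1, Measure.map_map measurable_fst hm,
      Measure.map_map hg measurable_fst]
    rfl
  · rw [Measure.map_map measurable_snd hm]
    exact h2

theorem W2sq_le_integral_of_map {n : ℕ} {y : Fin n → ℝ} {ν : Measure ℝ} {γ : Measure (ℝ × ℝ)}
    (hγ : γ ∈ couplings (empirical y) ν) {g : ℝ → ℝ} (hg : Measurable g)
    (hL : MemLp (fun p : ℝ × ℝ => g p.1 - p.2) 2 γ) :
    W2sq (empirical (g ∘ y)) ν ≤ ENNReal.ofReal (∫ p, (g p.1 - p.2) ^ 2 ∂γ) := by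
  refine (W2sq_le_of_coupling (map_mem_couplings hγ hg)).trans_eq ?_
  rw [lintegral_map (by fun_prop) (by fun_prop), ofReal_integral_sq hL]

theorem sq_sub_le_one_add_mul {δ : ℝ} (hδ : 0 < δ) (a b : ℝ) :
    (a - b) ^ 2 ≤ (1 + δ) * a ^ 2 + (1 + δ⁻¹) * b ^ 2 := by
  have h : (1 + δ) * a ^ 2 + (1 + δ⁻¹) * b ^ 2 - (a - b) ^ 2 = δ⁻¹ * (δ * a + b) ^ 2 := by
    field_simp
    ring
  have : 0 ≤ δ⁻¹ * (δ * a + b) ^ 2 := by positivity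
  linarith

/-- The limit `ε → 0` comes first, at fixed `δ`, because `δ⁻¹` blows up as `δ → 0`. -/
theorem le_of_forall_pos_mul_add {q w C : ℝ}
    (h : ∀ ε > 0, ∀ δ > 0, w ≤ (1 + δ) * q + (1 + δ⁻¹) * (C * ε)) : w ≤ q := by
  have h1 (δ : ℝ) (hδ : 0 < δ) : w ≤ (1 + δ) * q := by
    have ht : Filter.Tendsto (fun ε : ℝ => (1 + δ) * q + (1 + δ⁻¹) * (C * ε))
        (nhdsWithin 0 (Ioi 0)) (nhds ((1 + δ) * q + (1 + δ⁻¹) * (C * 0))) :=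
      (Continuous.tendsto (by fun_prop) 0).mono_left nhdsWithin_le_nhds
    have := ge_of_tendsto ht (by filter_upwards [self_mem_nhdsWithin] with ε hε using h ε hε δ hδ)
    simpa using this
  have ht : Filter.Tendsto (fun δ : ℝ => (1 + δ) * q) (nhdsWithin 0 (Ioi 0))
      (nhds ((1 + 0) * q)) :=
    (Continuous.tendsto (by fun_prop) 0).mono_left nhdsWithin_le_nhds
  have := ge_of_tendsto ht (by filter_upwards [self_mem_nhdsWithin] with δ hδ using h1 δ hδ)
  simpa using this

/-- If `ν` continues the geodesic from `empirical x` to `empirical y` up to time `T`, then no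
relabelling of the atoms improves on the cost `T² w` of the straight-line extrapolation. -/
theorem sq_mul_cost_le_of_extension {n : ℕ} (hn : 0 < n) {x y : Fin n → ℝ}
    (hy : Function.Injective y) {ν : Measure ℝ} {T w : ℝ} (hT : 1 < T)
    (hw : w = (n : ℝ)⁻¹ * ∑ i, (x i - y i) ^ 2)
    (h0 : W2sq (empirical x) ν = ENNReal.ofReal (T ^ 2 * w))
    (h1 : W2sq (empirical y) ν = ENNReal.ofReal ((T - 1) ^ 2 * w)) (σ : Equiv.Perm (Fin n)) :
    T ^ 2 * w ≤ (n : ℝ)⁻¹ * ∑ i, (x (σ i) - ((1 - T) * x i + T * y i)) ^ 2 := by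
  have hw0 : 0 ≤ w := by rw [hw]; positivity
  -- `α` relabels with the permutation and `β` without it; both push `empirical y` to `empirical x`.
  obtain ⟨α, hα, hαy⟩ := exists_measurable_apply_eq hy (x ∘ σ)
  obtain ⟨β, hβ, hβy⟩ := exists_measurable_apply_eq hy x
  refine le_of_forall_pos_mul_add (C := T) fun ε hε δ hδ => ?_
  obtain ⟨γ, hγ, hcost⟩ : ∃ γ ∈ couplings (empirical y) ν,
      ∫⁻ p, ‖p.1 - p.2‖ₑ ^ 2 ∂γ < ENNReal.ofReal ((T - 1) ^ 2 * w + ε) := by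
    have : W2sq (empirical y) ν < ENNReal.ofReal ((T - 1) ^ 2 * w + ε) := by
      rw [h1, ENNReal.ofReal_lt_ofReal_iff (by positivity)]
      linarith
    simpa only [W2sq, iInf_lt_iff, exists_prop] using this
  have hfst := hγ.2.1
  have hL : MemLp (fun p : ℝ × ℝ => p.1 - p.2) 2 γ :=
    memLp_two_of_lintegral_lt_top (by fun_prop) (hcost.trans ENNReal.ofReal_lt_top)
  have hLα : MemLp (fun p : ℝ × ℝ => α p.1 - p.2) 2 γ := by
    convert hL.add (memLp_two_comp_fst hn hfst (hα.sub measurable_id)) using 2 with p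
    simp
  have hLβ : MemLp (fun p : ℝ × ℝ => β p.1 - p.2) 2 γ := by
    convert hL.add (memLp_two_comp_fst hn hfst (hβ.sub measurable_id)) using 2 with p
    simp
  have hE : ∫ p, (p.1 - p.2) ^ 2 ∂γ ≤ (T - 1) ^ 2 * w + ε := by
    rw [← ofReal_integral_sq hL] at hcost
    exact ((ENNReal.ofReal_lt_ofReal_iff (by positivity)).1 hcost).le
  have hnonneg (f : ℝ × ℝ → ℝ) : 0 ≤ ∫ p, f p ^ 2 ∂γ := integral_nonneg fun p => sq_nonneg _
  have hEα : T ^ 2 * w ≤ ∫ p, (α p.1 - p.2) ^ 2 ∂γ := by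
    have := W2sq_le_integral_of_map hγ hα hLα
    rw [show α ∘ y = x ∘ σ from funext hαy, empirical_comp_perm, h0] at this
    exact (ENNReal.ofReal_le_ofReal_iff (hnonneg _)).1 this
  have hEβ : T ^ 2 * w ≤ ∫ p, (β p.1 - p.2) ^ 2 ∂γ := by
    have := W2sq_le_integral_of_map hγ hβ hLβ
    rw [show β ∘ y = x from funext hβy, h0] at this
    exact (ENNReal.ofReal_le_ofReal_iff (hnonneg _)).1 this
  have hLD : MemLp (fun p : ℝ × ℝ => β p.1 - p.1) 2 γ :=
    memLp_two_comp_fst hn hfst (hβ.sub measurable_id)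
  have hED : ∫ p, (β p.1 - p.1) ^ 2 ∂γ = w := by
    rw [integral_comp_fst (g := fun r => (β r - r) ^ 2) hfst (by fun_prop), hw]
    simp only [hβy]
  have hLA : MemLp (fun p : ℝ × ℝ => α p.1 - ((1 - T) * β p.1 + T * p.1)) 2 γ :=
    memLp_two_comp_fst (g := fun r => α r - ((1 - T) * β r + T * r)) hn hfst (by fun_prop)
  have hEA : ∫ p, (α p.1 - ((1 - T) * β p.1 + T * p.1)) ^ 2 ∂γ
      = (n : ℝ)⁻¹ * ∑ i, (x (σ i) - ((1 - T) * x i + T * y i)) ^ 2 := by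
    rw [integral_comp_fst (g := fun r => (α r - ((1 - T) * β r + T * r)) ^ 2) hfst
      (by fun_prop)]
    simp only [hβy, hαy, Function.comp]
  have hLR : MemLp (fun p : ℝ × ℝ => p.2 - ((1 - T) * β p.1 + T * p.1)) 2 γ := by
    convert hLA.sub hLα using 2 with p
    simp
  have hER : ∫ p, (p.2 - ((1 - T) * β p.1 + T * p.1)) ^ 2 ∂γ ≤ T * ε := by
    have hI : Integrable
        (fun p : ℝ × ℝ => T * (p.1 - p.2) ^ 2 - (T - 1) * (β p.1 - p.2) ^ 2) γ :=
      (hL.integrable_sq.const_mul _).sub (hLβ.integrable_sq.const_mul _)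
    -- Pointwise this is the Euclidean identity for an affine combination. After inserting the
    -- bounds, the multiples of `w` cancel and only `T * ε` survives.
    have : ∫ p, (p.2 - ((1 - T) * β p.1 + T * p.1)) ^ 2 ∂γ
        = T * ∫ p, (p.1 - p.2) ^ 2 ∂γ - (T - 1) * ∫ p, (β p.1 - p.2) ^ 2 ∂γ
          + T * (T - 1) * ∫ p, (β p.1 - p.1) ^ 2 ∂γ := by
      rw [← integral_const_mul, ← integral_const_mul, ← integral_const_mul,
        ← integral_sub (hL.integrable_sq.const_mul _) (hLβ.integrable_sq.const_mul _),
        ← integral_add hI (hLD.integrable_sq.const_mul _)]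
      exact integral_congr_ae (ae_of_all _ fun p => by ring)
    rw [this, hED]
    have e1 := mul_le_mul_of_nonneg_left hE (by linarith : 0 ≤ T)
    have e2 := mul_le_mul_of_nonneg_left hEβ (by linarith : 0 ≤ T - 1)
    linarith
  refine hEα.trans ?_
  rw [← hEA]
  calc ∫ p, (α p.1 - p.2) ^ 2 ∂γ
      ≤ ∫ p, ((1 + δ) * (α p.1 - ((1 - T) * β p.1 + T * p.1)) ^ 2
          + (1 + δ⁻¹) * (p.2 - ((1 - T) * β p.1 + T * p.1)) ^ 2) ∂γ := by
        refine integral_mono hLα.integrable_sq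
          ((hLA.integrable_sq.const_mul _).add (hLR.integrable_sq.const_mul _)) fun p => ?_
        have := sq_sub_le_one_add_mul hδ (α p.1 - ((1 - T) * β p.1 + T * p.1))
          (p.2 - ((1 - T) * β p.1 + T * p.1))
        simpa only [sub_sub_sub_cancel_right] using this
    _ ≤ _ := by
        rw [integral_add (hLA.integrable_sq.const_mul _) (hLR.integrable_sq.const_mul _),
          integral_const_mul, integral_const_mul]
        gcongr

/-- The squares cancel, so the swap changes the sum of squares by `2 (x j - x i) (z j - z i)`. -/
theorem le_of_cost_le_swap {n : ℕ} (hn : 0 < n) {x z : Fin n → ℝ} {i j : Fin n}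
    (hij : x i < x j)
    (h : (n : ℝ)⁻¹ * ∑ k, (x k - z k) ^ 2
      ≤ (n : ℝ)⁻¹ * ∑ k, (x (Equiv.swap i j k) - z k) ^ 2) : z i ≤ z j := by
  have hne : i ≠ j := fun e => hij.ne (congrArg x e)
  have h := le_of_mul_le_mul_left h (by positivity)
  have hsq : ∑ k, x (Equiv.swap i j k) ^ 2 = ∑ k, x k ^ 2 :=
    Equiv.sum_comp (Equiv.swap i j) fun k => x k ^ 2
  have hd : ∑ k, (x (Equiv.swap i j k) - x k) * z k = (x j - x i) * z i + (x i - x j) * z j := by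
    rw [← Finset.sum_subset (Finset.subset_univ {i, j}), Finset.sum_pair hne]
    · simp
    · intro k _ hk
      simp only [Finset.mem_insert, Finset.mem_singleton, not_or] at hk
      rw [Equiv.swap_apply_of_ne_of_ne hk.1 hk.2, sub_self, zero_mul]
  simp only [sub_mul, sub_sq, Finset.sum_add_distrib, Finset.sum_sub_distrib, mul_assoc,
    ← Finset.mul_sum] at h hd
  nlinarith

theorem nonpos_of_forall_add_mul_nonpos {a b : ℝ} (h : ∀ T > 1, a + T * b ≤ 0) : b ≤ 0 := by
  by_contra! hb
  -- At this `T` the expression is `a + |a| + 2 b > 0`.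
  have h1 := h (2 + |a| / b) (by have : 0 ≤ |a| / b := by positivity
                                 linarith)
  rw [add_mul, div_mul_cancel₀ _ hb.ne'] at h1
  linarith [neg_abs_le a]

theorem sub_le_sub_of_extendsToRay {n : ℕ} (hn : 0 < n) {x y : Fin n → ℝ}
    (hx : StrictMono x) (hy : StrictMono y)
    (h : GeodesicExtendsToRay (empirical x) (empirical y)) {i j : Fin n} (hij : i < j) :
    y i - y j ≤ x i - x j := by
  obtain ⟨c, ⟨-, hc⟩, hext⟩ := h
  have hc0 : c 0 = empirical x := by
    simpa using (hext 0 (by simp)).trans (geodesicCurve_empirical hn hx hy 0)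
  have hc1 : c 1 = empirical y := by
    simpa using (hext 1 (by simp)).trans (geodesicCurve_empirical hn hx hy 1)
  have hW := W2sq_empirical hn hx hy
  suffices (y i - y j) - (x i - x j) ≤ 0 by linarith
  -- `z i - z j` is affine in `T`, with the target quantity as its slope.
  refine nonpos_of_forall_add_mul_nonpos (a := x i - x j) fun T hT => ?_
  have h0 := hc T 0 (by linarith) le_rfl
  rw [W2_eq_ofReal_mul_iff (abs_nonneg _), hc0, hc1, hW, sq_abs, zero_sub, neg_sq,
    ← ENNReal.ofReal_mul (by positivity)] at h0
  have h1 := hc T 1 (by linarith) zero_le_one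
  rw [W2_eq_ofReal_mul_iff (abs_nonneg _), hc0, hc1, hW, sq_abs, ← neg_sq, neg_sub,
    ← ENNReal.ofReal_mul (by positivity)] at h1
  have key := sq_mul_cost_le_of_extension hn hy.injective hT rfl h0 h1 (Equiv.swap i j)
  have hz := le_of_cost_le_swap hn (z := fun k => (1 - T) * x k + T * y k) (hx hij) <| by
    refine le_trans (le_of_eq ?_) key
    rw [mul_left_comm, Finset.mul_sum _ _ (T ^ 2)]
    congr 1
    exact Finset.sum_congr rfl fun k _ => by ring
  linarith

theorem corollary1 (n : ℕ) (hn : 0 < n) (x y : Fin n → ℝ)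
    (hx : StrictMono x) (hy : StrictMono y) :
    (GeodesicExtendsToRay (empirical x) (empirical y) ↔
      ∀ i j : Fin n, i < j → y i - y j ≤ x i - x j) ∧
    (IsGeodesicRay (geodesicCurve (empirical x) (empirical y)) ↔
      ∀ i j : Fin n, i < j → y i - y j ≤ x i - x j) := by
  have hext : IsGeodesicRay (geodesicCurve (empirical x) (empirical y)) →
      GeodesicExtendsToRay (empirical x) (empirical y) := fun h => ⟨_, h, fun _ _ => rfl⟩
  have hnec (h : GeodesicExtendsToRay (empirical x) (empirical y)) (i j : Fin n) (hij : i < j) :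
      y i - y j ≤ x i - x j := sub_le_sub_of_extendsToRay hn hx hy h hij
  have hsuff := isGeodesicRay_geodesicCurve hn hx hy
  exact ⟨⟨hnec, fun h => hext (hsuff h)⟩, ⟨fun h => hnec (hext h), hsuff⟩⟩
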